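/- Let $d\in\{1,2\}$. Consider an overlapping convolutional arithmetic circuit on the grid $\{0,\dots,H-1\}^d$ of $N=H^d$ sites with local dimension $M\ge 2$. Its input, for $s\in\{1,\dots,M\}^N$, consists of the standard basis vectors $\hat e^{(s_j)}\in\mathbb R^M$, one per site $j$. It has $n\ge 1$ layers $l=0,\dots,n-1$, with $r_l\ge 2$ output channels, followed by a global pooling layer with one output channel. The layers alternate, beginning with a convolution: even $l$ is a convolution layer with window $R=K$, stride $S=1$, and anchor $o\in\{0,\dots,K-1\}$ ($o=0$: kernel anchored at its corner; $o=\lfloor K/2\rfloor$: at its centre), where $K\ge2$; odd $l$ is a pooling layer with window $R=2$, stride $S=2$ and $o=0$, which halves the linear size of the grid ($2^{\lfloor n/2\rfloor}$ divides $H$). A layer with window $R$, stride $S$ and anchor $o$ maps a grid of vectors $x$ to the grid of vectors $$ y_p=\bigodot_{w\in\{0,\dots,R-1\}^d} W^{(w)}x_{Sp+w-o}, $$ where $\odot$ is the entrywise product, the real matrices $W^{(w)}$ do not depend on $p$, and locations $Sp+w-o$ outside the input grid contribute no factor. Global pooling is such a layer whose window is its whole input grid. The scalar output $y(\hat e^{(s_1)},\dots,\hat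 e^{(s_N)})$ is the amplitude $\psi_{s_1\cdots s_N}$ of the state represented by the network. For a set $A$ of sites with complement $B$, let $\mathrm{maxEE}$ be the supremum, over all weights for which $\psi\neq0$, of the entanglement entropy of $\psi/\|\psi\|$ with respect to $(A,B)$, i.e. of the von Neumann entropy $-\mathrm{tr}(\rho_A\log\rho_A)$ of its reduced density matrix on $A$. Then $$ \mathrm{maxEE}=\Omega\bigl(\min\{\alpha^d,\;K\alpha^{d-1}\}\bigr) $$ whenever $A$ is a cube of linear size $\alpha\ge1$ in the grid (an interval of $\alpha$ sites for $d=1$, an $\alpha\times\alpha$ square for $d=2$) with $|A|\le|B|$. That is, there is an absolute constant $c>0$, independent of $d,n,K,o,M,H,\alpha$, of the channel numbers $r_l$ and of the position of $A$, such that $\mathrm{maxEE}\ge c\,\min\{\alpha^d,K\alpha^{d-1}\}$. -/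

import Mathlib

namespace ConvAC

/-- One generalized convolutional layer with product pooling in `d` spatial dimensions: receptive
field `R^d`, stride `S`, weights `W w` (one matrix per window location `w`). The window of the
output position `p` covers the input positions `S * p + w - o`, `w ∈ {0, …, R-1}^d`, so that
`o = 0` puts the corner of the window, and `o = R / 2` its centre, at `S * p`. The output is the
entrywise product, over the window locations that lie inside the input grid, of the vectors
`W w *ᵥ x`; window locations beyond the boundary contribute no factor. -/
def gcLayer {d : ℕ} (Hin Hout R S o : ℕ) {rin rout : ℕ}
    (W : (Fin d → Fin R) → Matrix (Fin rout) (Fin rin) ℝ)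
    (x : (Fin d → Fin Hin) → Fin rin → ℝ) :
    (Fin d → Fin Hout) → Fin rout → ℝ :=
  fun p c => ∏ w : Fin d → Fin R,
    if h : ∀ i, o ≤ S * (p i : ℕ) + (w i : ℕ) ∧ S * (p i : ℕ) + (w i : ℕ) - o < Hin then
      Matrix.mulVec (W w) (x fun i => ⟨S * (p i : ℕ) + (w i : ℕ) - o, (h i).2⟩) c
    else 1

/-! The layers are numbered `0, 1, 2, …`; the even ones are convolution layers (receptive field
`K^d`, stride `1`, anchor `o`), the odd ones are pooling layers (receptive field `2^d`,
stride `2`). -/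

/-- Linear size of the receptive field of layer `l`. -/
def field (K l : ℕ) : ℕ := if Even l then K else 2

/-- Stride of layer `l`. -/
def stride (l : ℕ) : ℕ := if Even l then 1 else 2

/-- Anchor of the windows of layer `l`. -/
def anchor (o l : ℕ) : ℕ := if Even l then o else 0

/-- Linear size of the grid that is the input of layer `l`, when the network input has linear
size `H`. -/
def extent (H : ℕ) : ℕ → ℕ
  | 0 => H
  | l + 1 => extent H l / stride l

/-- Number of channels of the input of layer `l`: the network input has `M` channels and the
output of layer `l` has `r l` channels. -/
def channels (M : ℕ) (r : ℕ → ℕ) : ℕ → ℕ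
  | 0 => M
  | l + 1 => r l

/-- The free parameters of a network with `n` layers followed by global pooling: a weight matrix
for every window location of every layer (only the layers `l < n` are used), and a row vector for
every location of the global pooling window. -/
structure Params (d n K M H : ℕ) (r : ℕ → ℕ) where
  /-- Weights of the convolution and pooling layers. -/
  W : ∀ l : ℕ, (Fin d → Fin (field K l)) →
    Matrix (Fin (channels M r (l + 1))) (Fin (channels M r l)) ℝ
  /-- Weights of the global pooling layer, which has a single output channel. -/
  V : (Fin d → Fin (extent H n)) → Matrix (Fin 1) (Fin (channels M r n)) ℝ

/-- The input of layer `l` on the standard basis vectors `e_(s j)`, `j` a site of the grid. -/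
def activation {d n K M H : ℕ} {r : ℕ → ℕ} (o : ℕ) (θ : Params d n K M H r)
    (s : (Fin d → Fin H) → Fin M) :
    ∀ l : ℕ, (Fin d → Fin (extent H l)) → Fin (channels M r l) → ℝ
  | 0 => fun j => Pi.single (s j) 1
  | l + 1 => gcLayer (extent H l) (extent H (l + 1)) (field K l) (stride l) (anchor o l)
      (θ.W l) (activation o θ s l)

/-- The amplitudes `y(e_(s 1), …, e_(s N))` of the state represented by the network: the output of
the global pooling layer, whose window is the whole grid. -/
def state {d n K M H : ℕ} {r : ℕ → ℕ} (o : ℕ) (θ : Params d n K M H r)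
    (s : (Fin d → Fin H) → Fin M) : ℝ :=
  gcLayer (extent H n) 1 (extent H n) (extent H n) 0 θ.V (activation o θ s n)
    (fun _ => 0) 0

/-- The matricization of the order-`N` tensor `ψ` with respect to `(A, Aᶜ)`. -/
def matricization {ι : Type} [DecidableEq ι] {M : ℕ} (ψ : (ι → Fin M) → ℝ) (A : Finset ι) :
    Matrix ({j // j ∈ A} → Fin M) ({j // j ∉ A} → Fin M) ℝ :=
  Matrix.of fun a b => ψ fun j => if h : j ∈ A then a ⟨j, h⟩ else b ⟨j, h⟩

/-- The reduced density matrix on `A` of the normalized state `ψ / ‖ψ‖`. -/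
noncomputable def reducedDensity {ι : Type} [Fintype ι] [DecidableEq ι] {M : ℕ}
    (ψ : (ι → Fin M) → ℝ) (A : Finset ι) :
    Matrix ({j // j ∈ A} → Fin M) ({j // j ∈ A} → Fin M) ℝ :=
  (∑ s, ψ s ^ 2)⁻¹ • (matricization ψ A * (matricization ψ A).transpose)

theorem reducedDensity_isHermitian {ι : Type} [Fintype ι] [DecidableEq ι] {M : ℕ}
    (ψ : (ι → Fin M) → ℝ) (A : Finset ι) : (reducedDensity ψ A).IsHermitian := by
  ext i j
  simp [reducedDensity, Matrix.mul_apply, mul_comm]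

/-- The entanglement entropy of (the normalization of) `ψ ≠ 0` with respect to `(A, Aᶜ)`: the
von Neumann entropy `- tr (ρ log ρ)` of the reduced density matrix. -/
noncomputable def entanglementEntropy {ι : Type} [Fintype ι] [DecidableEq ι] {M : ℕ}
    (ψ : (ι → Fin M) → ℝ) (A : Finset ι) : ℝ :=
  ∑ i, Real.negMulLog ((reducedDensity_isHermitian ψ A).eigenvalues i)

/-- The maximal entanglement entropy with respect to `(A, Aᶜ)`: the supremum over all nonzero
states that the network represents as its weights vary. -/
noncomputable def maxEE (d n K o M H : ℕ) (r : ℕ → ℕ) (A : Finset (Fin d → Fin H)) : ℝ :=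
  sSup {e : ℝ | ∃ θ : Params d n K M H r, state o θ ≠ 0 ∧
    e = entanglementEntropy (state o θ) A}

/-- The cubic subsystem of linear size `α` with corner `t`. -/
def box {d : ℕ} (H α : ℕ) (t : Fin d → ℕ) : Finset (Fin d → Fin H) :=
  Finset.univ.filter fun j => ∀ i, t i ≤ (j i : ℕ) ∧ (j i : ℕ) < t i + α

end ConvAC

/-!
The entanglement comes from the first convolution alone. Let `β` be the parity of a basis state,
which reduces every site to a qubit. A convolution that reads `β` at two window locations whose
difference is `k` along the first axis, and is trivial elsewhere, outputs `β β'` in one channel; a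
second channel is kept constantly `1`, so that the next layer can form the sign `1 - 2 β β'` of a
controlled-`Z` gate. All later layers just multiply these signs together
(`ConvAC.activation_graphParams`). The weights are the same at all positions, and hence the network
represents a graph state whose edges are *all* pairs of sites at distance `k` along the first axis
(`ConvAC.state_graphParams`). The two window locations can be chosen on both sides of the anchor,
for every `k < K`; then no edge is lost at the boundary, and a window that is cut off by the
boundary only contributes a sign that is local to a site.

The von Neumann entropy is at least `-log (tr ρ²)` (`ConvAC.neg_log_le_entanglementEntropy`). In the
purity `tr ρ²` of a graph state the edges inside `A` or inside its complement cancel. If `m` sites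
of `A` are matched with `m` sites of the complement by edges, and the latter have no other neighbour
in `A`, then the purity is at most `(49 / 81) ^ m`
(`ConvAC.trace_reducedDensity_graphState_sq_le`). The constant does not depend on `M` because the
even and the odd basis states both have a share of at least `1 / 3`.

For a cube `A` of linear size `α` take `k = min α (K - 1)`. As `A` fills at most half of the grid,
there is room for at least `α / 5` sites beyond one of its two faces orthogonal to the first axis,
and the sites beyond that face, up to distance `k`, are matched with sites of `A`
(`ConvAC.mul_log_le_maxEE_box`). This gives `m ≥ min α K * α ^ (d - 1) / 5`.
-/

namespace ConvAC

/-! ### Entropy and purity -/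

section Entropy

variable {ι : Type} [Fintype ι] [DecidableEq ι] {M : ℕ}

/-- The configuration that is `a` on `A` and `b` on the complement of `A`. -/
def glue (A : Finset ι) (a : {j // j ∈ A} → Fin M) (b : {j // j ∉ A} → Fin M) : ι → Fin M :=
  fun j => if h : j ∈ A then a ⟨j, h⟩ else b ⟨j, h⟩

theorem sum_eq_sum_glue (A : Finset ι) (f : (ι → Fin M) → ℝ) :
    ∑ s, f s = ∑ a, ∑ b, f (glue A a b) := by
  rw [← Fintype.sum_prod_type']
  refine Fintype.sum_equiv (Equiv.piEquivPiSubtypeProd (· ∈ A) fun _ => Fin M) _ _ fun s => ?_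
  congr 1
  funext j
  simp [glue, Equiv.piEquivPiSubtypeProd]

theorem _root_.Matrix.IsHermitian.trace_mul_self_eq_sum_sq_eigenvalues {m : Type*} [Fintype m]
    [DecidableEq m] {ρ : Matrix m m ℝ} (hρ : ρ.IsHermitian) :
    (ρ * ρ).trace = ∑ i, hρ.eigenvalues i ^ 2 := by
  conv_lhs => rw [hρ.spectral_theorem, ← map_mul, Unitary.conjStarAlgAut_apply,
    Matrix.trace_mul_cycle]
  simp [Matrix.trace, pow_two]

theorem reducedDensity_posSemidef (ψ : (ι → Fin M) → ℝ) (A : Finset ι) :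
    (reducedDensity ψ A).PosSemidef := by
  have h := Matrix.posSemidef_self_mul_conjTranspose (matricization ψ A)
  rw [Matrix.conjTranspose_eq_transpose_of_trivial] at h
  exact h.smul (inv_nonneg.2 (Finset.sum_nonneg fun _ _ => sq_nonneg _))

theorem trace_reducedDensity {ψ : (ι → Fin M) → ℝ} (hψ : ∑ s, ψ s ^ 2 ≠ 0) (A : Finset ι) :
    (reducedDensity ψ A).trace = 1 := by
  rw [reducedDensity, Matrix.trace_smul, smul_eq_mul, inv_mul_eq_one₀ hψ, sum_eq_sum_glue A]
  simp only [Matrix.trace, Matrix.diag, Matrix.mul_apply, Matrix.transpose_apply, matricization,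
    Matrix.of_apply, pow_two]
  rfl

theorem trace_reducedDensity_sq (ψ : (ι → Fin M) → ℝ) (A : Finset ι) :
    (reducedDensity ψ A * reducedDensity ψ A).trace =
      (∑ s, ψ s ^ 2)⁻¹ ^ 2 *
        ∑ a, ∑ a', (∑ b, ψ (glue A a b) * ψ (glue A a' b)) ^ 2 := by
  simp only [reducedDensity, Matrix.smul_mul, Matrix.mul_smul, Matrix.trace_smul, smul_eq_mul]
  rw [← mul_assoc, ← pow_two]
  congr 1
  simp only [Matrix.trace, Matrix.diag, Matrix.mul_apply, Matrix.transpose_apply, matricization,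
    Matrix.of_apply]
  refine Finset.sum_congr rfl fun a _ => Finset.sum_congr rfl fun a' _ => ?_
  rw [pow_two]
  congr 1
  exact Finset.sum_congr rfl fun b _ => mul_comm _ _

/-- The von Neumann entropy is at least the Rényi entropy of order two. -/
theorem neg_log_le_entanglementEntropy {ψ : (ι → Fin M) → ℝ} (hψ : ∑ s, ψ s ^ 2 ≠ 0)
    (A : Finset ι) {P : ℝ} (hP : 0 < P)
    (h : (reducedDensity ψ A * reducedDensity ψ A).trace ≤ P) :
    -Real.log P ≤ entanglementEntropy ψ A := by
  have hρ := reducedDensity_isHermitian ψ A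
  have h0 : ∀ i, 0 ≤ hρ.eigenvalues i := (reducedDensity_posSemidef ψ A).eigenvalues_nonneg
  have h1 : ∑ i, hρ.eigenvalues i = 1 := by
    have := hρ.trace_eq_sum_eigenvalues
    rw [trace_reducedDensity hψ A] at this
    simpa using this.symm
  rw [hρ.trace_mul_self_eq_sum_sq_eigenvalues] at h
  -- the tangent line of `log` at `P` bounds `-log` from below on every eigenvalue
  have key : ∀ x : ℝ, 0 ≤ x → x * (1 - Real.log P) - x ^ 2 / P ≤ Real.negMulLog x := by
    intro x hx
    rcases hx.eq_or_lt with rfl | hx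
    · simp
    have := Real.log_le_sub_one_of_pos (div_pos hx hP)
    rw [Real.log_div hx.ne' hP.ne'] at this
    have h2 := mul_le_mul_of_nonneg_left this hx.le
    have h3 : x * (x / P - 1) = x ^ 2 / P - x := by ring
    rw [Real.negMulLog]
    nlinarith
  have h2 : ∑ i, (hρ.eigenvalues i * (1 - Real.log P) - hρ.eigenvalues i ^ 2 / P) ≤
      entanglementEntropy ψ A := Finset.sum_le_sum fun i _ => key _ (h0 i)
  rw [Finset.sum_sub_distrib, ← Finset.sum_mul, ← Finset.sum_div, h1] at h2
  have h3 : (∑ i, hρ.eigenvalues i ^ 2) / P ≤ 1 := (div_le_one hP).2 h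
  linarith

theorem entanglementEntropy_le_card (ψ : (ι → Fin M) → ℝ) (A : Finset ι) :
    entanglementEntropy ψ A ≤ Fintype.card ({j // j ∈ A} → Fin M) := by
  have h0 := (reducedDensity_posSemidef ψ A).eigenvalues_nonneg
  calc entanglementEntropy ψ A ≤ ∑ _i : {j // j ∈ A} → Fin M, (1 : ℝ) :=
        Finset.sum_le_sum fun i _ =>
          (Real.negMulLog_le_one_sub_self (h0 i)).trans (sub_le_self _ (h0 i))
    _ = _ := by simp

end Entropy

theorem entanglementEntropy_le_maxEE {d n K o M H : ℕ} {r : ℕ → ℕ}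
    (A : Finset (Fin d → Fin H)) (θ : Params d n K M H r) (hθ : state o θ ≠ 0) :
    entanglementEntropy (state o θ) A ≤ maxEE d n K o M H r A :=
  le_csSup ⟨_, by rintro e ⟨θ', -, rfl⟩; exact entanglementEntropy_le_card _ A⟩ ⟨θ, hθ, rfl⟩

/-! ### Graph states and their purity -/

section GraphState

/-- The parity of a basis state: it reduces a site of local dimension `M ≥ 2` to a qubit whose two
values are taken by about half of the basis states each. -/
def parity {M : ℕ} (x : Fin M) : ℝ := ((x : ℕ) % 2 : ℕ)

theorem parity_eq {M : ℕ} (x : Fin M) : parity x = 0 ∨ parity x = 1 := by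
  rcases Nat.mod_two_eq_zero_or_one (x : ℕ) with h | h <;> simp [parity, h]

theorem sum_parity (M : ℕ) : ∑ x : Fin M, parity x = ((M / 2 : ℕ) : ℝ) := by
  have h : ∀ m : ℕ, ∑ i ∈ Finset.range m, ((i % 2 : ℕ) : ℝ) = ((m / 2 : ℕ) : ℝ) := by
    intro m
    induction m with
    | zero => simp
    | succ m ih =>
      rw [Finset.sum_range_succ, ih, ← Nat.cast_add]
      congr 1
      omega
  rw [← h M]
  exact Fin.sum_univ_eq_sum_range (fun i => ((i % 2 : ℕ) : ℝ)) M

theorem abs_sum_sign_le {M : ℕ} (hM : 2 ≤ M) :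
    |∑ x : Fin M, (1 - 2 * parity x)| ≤ (M : ℝ) * (1 / 3) := by
  rw [Finset.sum_sub_distrib, ← Finset.mul_sum, sum_parity]
  simp only [Finset.sum_const, Finset.card_univ, Fintype.card_fin, nsmul_eq_mul, mul_one]
  have h1 : (M : ℝ) = 2 * ((M / 2 : ℕ) : ℝ) + ((M % 2 : ℕ) : ℝ) := by
    exact_mod_cast (Nat.div_add_mod M 2).symm
  have h2 : 3 * ((M % 2 : ℕ) : ℝ) ≤ M := by
    have : 3 * (M % 2) ≤ M := by omega
    exact_mod_cast this
  have h3 : (0 : ℝ) ≤ ((M % 2 : ℕ) : ℝ) := Nat.cast_nonneg _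
  rw [abs_le]
  constructor <;> linarith

/-- The purity of the reduced state of two sites joined by an edge. The worst local dimension is
`M = 3`, where it is `49 / 81` exactly. -/
theorem sum_parity_ne_le {M : ℕ} (hM : 2 ≤ M) :
    ∑ z : Fin M × Fin M, (if parity z.1 ≠ parity z.2 then (1 / 9 : ℝ) else 1) ≤
      (M : ℝ) ^ 2 * (49 / 81) := by
  have h : ∀ z : Fin M × Fin M, (if parity z.1 ≠ parity z.2 then (1 / 9 : ℝ) else 1) =
      1 - 8 / 9 * (parity z.1 + parity z.2 - 2 * (parity z.1 * parity z.2)) := by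
    rintro ⟨x, y⟩
    rcases parity_eq x with hx | hx <;> rcases parity_eq y with hy | hy <;> simp [hx, hy] <;>
      norm_num
  simp only [h]
  rw [Fintype.sum_prod_type]
  simp only [Finset.sum_sub_distrib, Finset.sum_add_distrib, ← Finset.mul_sum, ← Finset.sum_mul,
    sum_parity, Finset.sum_const, Finset.card_univ, Fintype.card_fin, nsmul_eq_mul, mul_one]
  have h1 : (M : ℝ) = 2 * ((M / 2 : ℕ) : ℝ) + ((M % 2 : ℕ) : ℝ) := by
    exact_mod_cast (Nat.div_add_mod M 2).symm
  set S : ℝ := ((M / 2 : ℕ) : ℝ) with hS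
  have hS1 : (1 : ℝ) ≤ S := by
    have : 1 ≤ M / 2 := by omega
    rw [hS]
    exact_mod_cast this
  rcases Nat.mod_two_eq_zero_or_one M with h2 | h2
  · rw [h2, Nat.cast_zero, add_zero] at h1
    rw [h1]
    nlinarith
  · rw [h2, Nat.cast_one] at h1
    rw [h1]
    nlinarith

variable {ι P : Type} [Fintype P] {M : ℕ}

/-- The parity at an end of an edge; an end that is missing counts as parity `1`. -/
def endParity (u : Option ι) (s : ι → Fin M) : ℝ := u.elim 1 fun j => parity (s j)

/-- The sign that a controlled-`Z` gate on the ends `u`, `v` gives to a configuration. -/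
def edgeSign (u v : Option ι) (s : ι → Fin M) : ℝ := 1 - 2 * (endParity u s * endParity v s)

theorem endParity_eq (u : Option ι) (s : ι → Fin M) : endParity u s = 0 ∨ endParity u s = 1 := by
  cases u with
  | none => exact Or.inr rfl
  | some j => exact parity_eq _

theorem edgeSign_mul_self (u v : Option ι) (s : ι → Fin M) :
    edgeSign u v s * edgeSign u v s = 1 := by
  rcases endParity_eq u s with hu | hu <;> rcases endParity_eq v s with hv | hv <;>
    (simp [edgeSign, hu, hv]; try norm_num)

theorem abs_edgeSign (u v : Option ι) (s : ι → Fin M) : |edgeSign u v s| = 1 := by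
  have h := edgeSign_mul_self u v s
  rcases mul_self_eq_one_iff.1 h with h | h <;> simp [h]

theorem edgeSign_comm (u v : Option ι) (s : ι → Fin M) : edgeSign u v s = edgeSign v u s := by
  simp [edgeSign, mul_comm]

/-- The graph state, with all amplitudes `± 1`, whose edges have the ends `u p`, `v p`. -/
def graphState (u v : P → Option ι) (s : ι → Fin M) : ℝ := ∏ p, edgeSign (u p) (v p) s

theorem graphState_mul_self (u v : P → Option ι) (s : ι → Fin M) :
    graphState u v s * graphState u v s = 1 := by
  rw [graphState, ← Finset.prod_mul_distrib]
  exact Finset.prod_eq_one fun p _ => edgeSign_mul_self _ _ _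

theorem sum_graphState_sq [Fintype ι] [DecidableEq ι] (u v : P → Option ι) :
    ∑ s : ι → Fin M, graphState u v s ^ 2 = (M : ℝ) ^ Fintype.card ι := by
  simp [pow_two, graphState_mul_self]

/-- A sum of products of factors that each depend on at most one coordinate is bounded by the
product of one-coordinate sums. -/
theorem abs_sum_prod_le_of_local {β X : Type} [Fintype β] [DecidableEq β] [Fintype X]
    (f : P → (β → X) → ℝ) (site : P → Option β)
    (hloc : ∀ p b b', (∀ j, site p = some j → b j = b' j) → f p b = f p b')
    (hle : ∀ p b, |f p b| ≤ 1) :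
    |∑ b, ∏ p, f p b| ≤ ∏ j, |∑ x, ∏ p with site p = some j, f p fun _ => x| := by
  rcases isEmpty_or_nonempty (β → X) with hE | ⟨⟨b₀⟩⟩
  · rw [Finset.univ_eq_empty, Finset.sum_empty, abs_zero]
    exact Finset.prod_nonneg fun _ _ => abs_nonneg _
  have h : ∀ b, ∏ p, f p b = (∏ p with site p = none, f p b₀) *
      ∏ j, ∏ p with site p = some j, f p fun _ => b j := by
    intro b
    rw [← Finset.prod_fiberwise Finset.univ site, Fintype.prod_option]
    congr 1
    · refine Finset.prod_congr rfl fun p hp => hloc _ _ _ fun j hj => ?_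
      simp [hj] at hp
    · refine Finset.prod_congr rfl fun j _ => Finset.prod_congr rfl fun p hp =>
        hloc _ _ _ fun i hi => ?_
      have := (Finset.mem_filter.1 hp).2.symm.trans hi
      rw [Option.some_inj.1 this]
  simp only [h]
  rw [← Finset.mul_sum, ← Fintype.prod_sum fun j x => ∏ p with site p = some j, f p fun _ => x,
    abs_mul, Finset.abs_prod, Finset.abs_prod]
  refine mul_le_of_le_one_left (Finset.prod_nonneg fun _ _ => abs_nonneg _) ?_
  exact Finset.prod_le_one (fun _ _ => abs_nonneg _) fun p _ => hle p b₀

/-- The edge with ends `u`, `v` joins the sites `j` and `i`. -/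
def Joins (u v : Option ι) (j i : ι) : Prop :=
  u = some j ∧ v = some i ∨ u = some i ∧ v = some j

variable [DecidableEq ι]

/-- The end `u`, as a site outside `A`. -/
def outside (A : Finset ι) (u : Option ι) : Option {j // j ∉ A} :=
  u.bind fun j => if h : j ∈ A then none else some ⟨j, h⟩

theorem outside_eq_some {A : Finset ι} {u : Option ι} {j : {j // j ∉ A}} :
    outside A u = some j ↔ u = some j.1 := by
  cases u with
  | none => simp [outside]
  | some k =>
    by_cases h : k ∈ A
    · simp only [outside, Option.bind_some, h, dif_pos, reduceCtorEq, Option.some_inj, false_iff]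
      rintro rfl
      exact j.2 h
    · simp [outside, h, Subtype.ext_iff]

theorem endParity_glue_congr_right {A : Finset ι} {u : Option ι} (a : {j // j ∈ A} → Fin M)
    {b b' : {j // j ∉ A} → Fin M} (h : ∀ j, outside A u = some j → b j = b' j) :
    endParity u (glue A a b) = endParity u (glue A a b') := by
  cases u with
  | none => rfl
  | some k =>
    by_cases hk : k ∈ A
    · simp [endParity, glue, hk]
    · have := h ⟨k, hk⟩ (outside_eq_some.2 rfl)
      simp [endParity, glue, hk, this]

theorem endParity_glue_congr_left {A : Finset ι} {u : Option ι} (a a' : {j // j ∈ A} → Fin M)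
    (b : {j // j ∉ A} → Fin M) (h : ∀ i ∈ A, u ≠ some i) :
    endParity u (glue A a b) = endParity u (glue A a' b) := by
  cases u with
  | none => rfl
  | some k =>
    have hk : k ∉ A := fun hk => h k hk rfl
    simp [endParity, glue, hk]

variable {u v : P → Option ι} {A : Finset ι}

/-- Edges with no end in `A` cancel in the product of the amplitudes of two configurations that
agree outside `A`. -/
theorem edgeSign_mul_edgeSign_of_not_mem (a a' : {j // j ∈ A} → Fin M)
    (b : {j // j ∉ A} → Fin M) {y z : Option ι} (hy : ∀ i ∈ A, y ≠ some i)
    (hz : ∀ i ∈ A, z ≠ some i) :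
    edgeSign y z (glue A a b) * edgeSign y z (glue A a' b) = 1 := by
  have : edgeSign y z (glue A a b) = edgeSign y z (glue A a' b) := by
    rw [edgeSign, edgeSign, endParity_glue_congr_left a a' b hy,
      endParity_glue_congr_left a a' b hz]
  rw [this, edgeSign_mul_self]

theorem edgeSign_mul_edgeSign_of_joins (a a' : {j // j ∈ A} → Fin M)
    (b : {j // j ∉ A} → Fin M) {y z : Option ι} {j : {j // j ∉ A}} {i : {i // i ∈ A}}
    (h : Joins y z j.1 i.1) :
    edgeSign y z (glue A a b) * edgeSign y z (glue A a' b) =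
      (1 - 2 * (parity (b j) * parity (a i))) * (1 - 2 * (parity (b j) * parity (a' i))) := by
  rcases h with ⟨rfl, rfl⟩ | ⟨rfl, rfl⟩
  · simp [edgeSign, endParity, glue, j.2, i.2]
  · rw [edgeSign_comm (some i.1), edgeSign_comm (some i.1)]
    simp [edgeSign, endParity, glue, j.2, i.2]

variable [Fintype ι]

/-- Each matched edge whose two parities differ costs the overlap of two rows of the
matricization a factor `1 / 3`. -/
theorem abs_sum_graphState_mul_le (hM : 2 ≤ M) (I : Finset {j // j ∈ A})
    (ν : {j // j ∈ A} → {j // j ∉ A}) (e : {j // j ∈ A} → P)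
    (hjoin : ∀ i ∈ I, Joins (u (e i)) (v (e i)) (ν i).1 i.1)
    (huniq : ∀ i ∈ I, ∀ p, ∀ i' ∈ A, Joins (u p) (v p) (ν i).1 i' → p = e i)
    (a a' : {j // j ∈ A} → Fin M) :
    |∑ b, graphState u v (glue A a b) * graphState u v (glue A a' b)| ≤
      (M : ℝ) ^ Fintype.card {j // j ∉ A} *
        (1 / 3) ^ (I.filter fun i => parity (a i) ≠ parity (a' i)).card := by
  classical
  set D := I.filter fun i => parity (a i) ≠ parity (a' i) with hD
  set f : P → ({j // j ∉ A} → Fin M) → ℝ := fun p b =>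
    edgeSign (u p) (v p) (glue A a b) * edgeSign (u p) (v p) (glue A a' b) with hf
  set site : P → Option {j // j ∉ A} := fun p => (outside A (u p)).or (outside A (v p)) with hsite
  have habs : ∀ p b, |f p b| = 1 := fun p b => by
    rw [hf, abs_mul, abs_edgeSign, abs_edgeSign, one_mul]
  have hloc : ∀ p b b', (∀ j, site p = some j → b j = b' j) → f p b = f p b' := by
    intro p b b' h
    have hu : ∀ j, outside A (u p) = some j → b j = b' j := fun j hj => h j (by simp [hsite, hj])
    rcases hv : outside A (v p) with _ | k
    · have hv' : ∀ j, outside A (v p) = some j → b j = b' j := by simp [hv]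
      simp only [hf, edgeSign, endParity_glue_congr_right _ hu, endParity_glue_congr_right _ hv']
    rcases hu' : outside A (u p) with _ | k'
    · have hv' : ∀ j, outside A (v p) = some j → b j = b' j := fun j hj =>
        h j (by simp [hsite, hu', hj])
      simp only [hf, edgeSign, endParity_glue_congr_right _ hu, endParity_glue_congr_right _ hv']
    · -- both ends outside `A`: the factor is constant
      have h1 : ∀ i ∈ A, u p ≠ some i := fun i hi hc => by
        rw [outside_eq_some.1 hu', Option.some_inj] at hc
        exact k'.2 (hc ▸ hi)
      have h2 : ∀ i ∈ A, v p ≠ some i := fun i hi hc => by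
        rw [outside_eq_some.1 hv, Option.some_inj] at hc
        exact k.2 (hc ▸ hi)
      simp only [hf, edgeSign_mul_edgeSign_of_not_mem a a' _ h1 h2]
  -- an edge determines its end in `A`, so distinct matched sites have distinct partners
  have hinj : Set.InjOn ν D := by
    intro i hi i' hi' hν
    have hi := hjoin i (Finset.mem_filter.1 hi).1
    have hI' := (Finset.mem_filter.1 hi').1
    have hi' := hjoin i' hI'
    have he : e i = e i' := huniq i' hI' (e i) i.1 i.2 (hν ▸ hi)
    rw [he, hν] at hi
    rcases hi with ⟨h1, h2⟩ | ⟨h1, h2⟩ <;> rcases hi' with ⟨h3, h4⟩ | ⟨h3, h4⟩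
    · exact Subtype.ext (Option.some_inj.1 (h2.symm.trans h4))
    · exact absurd (Option.some_inj.1 (h2.symm.trans h4)) fun h => (ν i').2 (h ▸ i.2)
    · exact absurd (Option.some_inj.1 (h1.symm.trans h3)) fun h => (ν i').2 (h ▸ i.2)
    · exact Subtype.ext (Option.some_inj.1 (h1.symm.trans h3))
  -- for the partner of a site of `D` only the matched edge survives, and it leaves the sum of the
  -- signs `1 - 2 β`
  have hcol : ∀ j : {j // j ∉ A}, |∑ x : Fin M, ∏ p with site p = some j, f p fun _ => x| ≤
      M * if j ∈ D.image ν then (1 / 3 : ℝ) else 1 := by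
    intro j
    split_ifs with hj
    · obtain ⟨i, hi, rfl⟩ := Finset.mem_image.1 hj
      obtain ⟨hiI, hne⟩ := Finset.mem_filter.1 hi
      have hfib : ∀ x : Fin M, ∏ p with site p = some (ν i), (f p fun _ => x) =
          1 - 2 * parity x := by
        intro x
        rw [Finset.prod_eq_single (e i)]
        · rw [hf]
          simp only
          rw [edgeSign_mul_edgeSign_of_joins a a' _ (hjoin i hiI)]
          rcases parity_eq (a i) with h1 | h1 <;> rcases parity_eq (a' i) with h2 | h2 <;>
            simp [h1, h2] at hne ⊢
        · intro p hp hpe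
          have hs : (outside A (u p)).or (outside A (v p)) = some (ν i) :=
            (Finset.mem_filter.1 hp).2
          rw [Option.or_eq_some_iff, outside_eq_some, outside_eq_some] at hs
          refine edgeSign_mul_edgeSign_of_not_mem a a' _ (fun i' hi' hc => ?_)
            fun i' hi' hc => ?_
          · rcases hs with hs | ⟨-, hs⟩
            · exact (ν i).2 (Option.some_inj.1 (hs.symm.trans hc) ▸ hi')
            · exact hpe (huniq i hiI p i' hi' (Or.inr ⟨hc, hs⟩))
          · rcases hs with hs | ⟨-, hs⟩
            · exact hpe (huniq i hiI p i' hi' (Or.inl ⟨hs, hc⟩))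
            · exact (ν i).2 (Option.some_inj.1 (hs.symm.trans hc) ▸ hi')
        · intro h
          refine absurd (Finset.mem_filter.2 ⟨Finset.mem_univ _, ?_⟩) h
          rw [hsite]
          simp only
          rw [Option.or_eq_some_iff]
          rcases hjoin i hiI with ⟨h1, -⟩ | ⟨h1, h2⟩
          · exact Or.inl (outside_eq_some.2 h1)
          · refine Or.inr ⟨?_, outside_eq_some.2 h2⟩
            simp [h1, outside, i.2]
      simp only [hfib]
      exact abs_sum_sign_le hM
    · refine (Finset.abs_sum_le_sum_abs _ _).trans ?_
      simp [Finset.abs_prod, habs]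
  calc |∑ b, graphState u v (glue A a b) * graphState u v (glue A a' b)|
      = |∑ b, ∏ p, f p b| := by simp only [graphState, Finset.prod_mul_distrib, hf]
    _ ≤ ∏ j, |∑ x : Fin M, ∏ p with site p = some j, f p fun _ => x| :=
        abs_sum_prod_le_of_local f site hloc fun p b => (habs p b).le
    _ ≤ ∏ j : {j // j ∉ A}, (M * if j ∈ D.image ν then (1 / 3 : ℝ) else 1) :=
        Finset.prod_le_prod (fun _ _ => abs_nonneg _) fun j _ => hcol j
    _ = _ := by
        rw [Finset.prod_mul_distrib, Finset.prod_const, Finset.card_univ, Finset.prod_ite_mem,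
          Finset.univ_inter, Finset.prod_const, Finset.card_image_of_injOn hinj]

theorem trace_reducedDensity_graphState_sq_le (hM : 2 ≤ M) (I : Finset {j // j ∈ A})
    (ν : {j // j ∈ A} → {j // j ∉ A}) (e : {j // j ∈ A} → P)
    (hjoin : ∀ i ∈ I, Joins (u (e i)) (v (e i)) (ν i).1 i.1)
    (huniq : ∀ i ∈ I, ∀ p, ∀ i' ∈ A, Joins (u p) (v p) (ν i).1 i' → p = e i) :
    (reducedDensity (M := M) (graphState u v) A * reducedDensity (graphState u v) A).trace ≤
      (49 / 81 : ℝ) ^ I.card := by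
  have hM0 : (M : ℝ) ≠ 0 := by
    have : M ≠ 0 := by omega
    exact_mod_cast this
  have hpair : ∀ a a' : {j // j ∈ A} → Fin M,
      (∑ b, graphState u v (glue A a b) * graphState u v (glue A a' b)) ^ 2 ≤
        ((M : ℝ) ^ Fintype.card {j // j ∉ A}) ^ 2 *
          ∏ i, if i ∈ I then (if parity (a i) ≠ parity (a' i) then (1 / 9 : ℝ) else 1) else 1 := by
    intro a a'
    refine (sq_le_sq' ?_ (le_of_abs_le
      (abs_sum_graphState_mul_le hM I ν e hjoin huniq a a'))).trans_eq ?_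
    · exact neg_le_of_abs_le (abs_sum_graphState_mul_le hM I ν e hjoin huniq a a')
    · rw [mul_pow, Finset.prod_ite_mem, Finset.univ_inter, Finset.prod_ite, Finset.prod_const,
        Finset.prod_const_one, mul_one, pow_right_comm (1 / 3 : ℝ)]
      norm_num
  have hsum : ∑ a : {j // j ∈ A} → Fin M, ∑ a' : {j // j ∈ A} → Fin M,
      (∏ i, if i ∈ I then (if parity (a i) ≠ parity (a' i) then (1 / 9 : ℝ) else 1) else 1) ≤
        ((M : ℝ) ^ Fintype.card {j // j ∈ A}) ^ 2 * (49 / 81) ^ I.card := by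
    have h1 : ∑ a : {j // j ∈ A} → Fin M, ∑ a' : {j // j ∈ A} → Fin M,
        (∏ i, if i ∈ I then (if parity (a i) ≠ parity (a' i) then (1 / 9 : ℝ) else 1) else 1) =
        ∏ i : {j // j ∈ A}, ∑ z : Fin M × Fin M,
          if i ∈ I then (if parity z.1 ≠ parity z.2 then (1 / 9 : ℝ) else 1) else 1 := by
      rw [Fintype.prod_sum, ← Fintype.sum_prod_type']
      exact (Fintype.sum_equiv (Equiv.arrowProdEquivProdArrow _ _ _) _ _ fun z => rfl).symm
    rw [h1, ← pow_mul, mul_comm _ 2, pow_mul, ← Finset.card_univ (α := {j // j ∈ A}),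
      ← Finset.prod_const, ← Finset.prod_const, ← Finset.univ_inter I, ← Finset.prod_ite_mem,
      ← Finset.prod_mul_distrib]
    refine Finset.prod_le_prod (fun i _ => Finset.sum_nonneg fun z _ => ?_) fun i _ => ?_
    · split_ifs <;> norm_num
    · rw [Finset.univ_inter]
      split_ifs
      · exact sum_parity_ne_le hM
      · simp [pow_two]
  have hcard : (M : ℝ) ^ Fintype.card ι =
      (M : ℝ) ^ Fintype.card {j // j ∈ A} * (M : ℝ) ^ Fintype.card {j // j ∉ A} := by
    rw [← pow_add, ← Fintype.card_sum]
    congr 1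
    exact Fintype.card_congr (Equiv.sumCompl (· ∈ A)).symm
  rw [trace_reducedDensity_sq, sum_graphState_sq, hcard]
  calc _ ≤ ((M : ℝ) ^ Fintype.card {j // j ∈ A} * (M : ℝ) ^ Fintype.card {j // j ∉ A})⁻¹ ^ 2 *
        (((M : ℝ) ^ Fintype.card {j // j ∉ A}) ^ 2 *
          (((M : ℝ) ^ Fintype.card {j // j ∈ A}) ^ 2 * (49 / 81) ^ I.card)) := by
        refine mul_le_mul_of_nonneg_left ?_ (sq_nonneg _)
        refine (Finset.sum_le_sum fun a _ => Finset.sum_le_sum fun a' _ => hpair a a').trans ?_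
        simp only [← Finset.mul_sum]
        exact mul_le_mul_of_nonneg_left hsum (sq_nonneg _)
    _ = _ := by field_simp

/-- Each matched edge across the cut contributes a constant amount of entanglement. -/
theorem card_mul_le_entanglementEntropy_graphState (hM : 2 ≤ M) (I : Finset {j // j ∈ A})
    (ν : {j // j ∈ A} → {j // j ∉ A}) (e : {j // j ∈ A} → P)
    (hjoin : ∀ i ∈ I, Joins (u (e i)) (v (e i)) (ν i).1 i.1)
    (huniq : ∀ i ∈ I, ∀ p, ∀ i' ∈ A, Joins (u p) (v p) (ν i).1 i' → p = e i) :
    I.card * Real.log (81 / 49) ≤ entanglementEntropy (M := M) (graphState u v) A := by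
  have h := neg_log_le_entanglementEntropy (ψ := graphState (M := M) u v)
    (by
      have : M ≠ 0 := by omega
      rw [sum_graphState_sq]
      positivity)
    A (by positivity) (trace_reducedDensity_graphState_sq_le hM I ν e hjoin huniq)
  rw [Real.log_pow, ← mul_neg, ← Real.log_inv] at h
  norm_num at h ⊢
  exact h

end GraphState

/-! ### Networks that represent graph states -/

section Network

/-- The window location with coordinate `c` along the first axis and the anchor `o` along the
other axes. -/
def axisLoc {d : ℕ} (o c : ℕ) (i : Fin d) : ℕ := if (i : ℕ) = 0 then c else o

/-- The input site seen by the output position `p` at the window location `axisLoc o c`: the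
translate of `p` by `c - o` along the first axis, if it lies in the grid. -/
def axisSite {d H : ℕ} (o c : ℕ) (p : Fin d → Fin H) : Option (Fin d → Fin H) :=
  if h : ∀ i, o ≤ p i + axisLoc o c i ∧ p i + axisLoc o c i - o < H then
    some fun i => ⟨p i + axisLoc o c i - o, (h i).2⟩
  else none

theorem mulVec_single_one_apply {rin rout : ℕ} (B : Matrix (Fin rout) (Fin rin) ℝ) (x : Fin rin)
    (c : Fin rout) : Matrix.mulVec B (Pi.single x 1) c = B c x := by
  rw [Matrix.mulVec_single_one, Matrix.col_apply]

/-- A convolution whose weights are the parity at two window locations and trivial elsewhere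
multiplies two parities. -/
theorem prod_gcLayer_parity {d Hin Hout R S o o' M rout : ℕ} (hd : 0 < d) (hH : Hout = Hin)
    (hS : S = 1) (ho' : o = o') (ho : o < R) {c₀ c₁ : ℕ} (hc₀ : c₀ < R) (hc₁ : c₁ < R) (hne : c₀ ≠ c₁)
    (W : (Fin d → Fin R) → Matrix (Fin rout) (Fin M) ℝ) (c : Fin rout)
    (hW : ∀ w x, W w c x =
      if (∀ i, (w i : ℕ) = axisLoc o c₀ i) ∨ (∀ i, (w i : ℕ) = axisLoc o c₁ i) then parity x else 1)
    (s : (Fin d → Fin Hin) → Fin M) :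
    ∏ p : Fin d → Fin Hout,
        (1 - 2 * gcLayer Hin Hout R S o' W (fun j => Pi.single (s j) 1) p c) =
      graphState (axisSite o c₀) (axisSite o c₁) s := by
  subst hH hS ho'
  refine Finset.prod_congr rfl fun p _ => ?_
  rw [edgeSign]
  congr 2
  have hlt : ∀ e < R, ∀ i : Fin d, axisLoc o e i < R := fun e he i => by
    unfold axisLoc
    split_ifs <;> assumption
  let loc : ∀ e < R, Fin d → Fin R := fun e he i => ⟨axisLoc o e i, hlt e he i⟩
  have hend : ∀ e (he : e < R), (e = c₀ ∨ e = c₁) →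
      (if h : ∀ i, o ≤ 1 * (p i : ℕ) + (loc e he i : ℕ) ∧
          1 * (p i : ℕ) + (loc e he i : ℕ) - o < Hout then
        Matrix.mulVec (W (loc e he)) (Pi.single (s fun i =>
          ⟨1 * (p i : ℕ) + (loc e he i : ℕ) - o, (h i).2⟩) 1) c else 1) =
      endParity (axisSite o e p) s := by
    intro e he hcase
    simp only [one_mul, axisSite, loc]
    split_ifs with h
    · rw [mulVec_single_one_apply, hW, if_pos]
      · rfl
      · rcases hcase with rfl | rfl
        · exact Or.inl fun i => rfl
        · exact Or.inr fun i => rfl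
    · rfl
  rw [← hend c₀ hc₀ (Or.inl rfl), ← hend c₁ hc₁ (Or.inr rfl)]
  refine Finset.prod_eq_mul (loc c₀ hc₀) (loc c₁ hc₁) ?_ ?_ (by simp) (by simp)
  · intro h
    have := congrArg Fin.val (congrFun h ⟨0, hd⟩)
    simp [loc, axisLoc] at this
    exact hne this
  · rintro w - ⟨h0, h1⟩
    split_ifs with h
    · rw [mulVec_single_one_apply, hW, if_neg]
      rintro (h | h)
      · exact h0 (funext fun i => Fin.ext (h i))
      · exact h1 (funext fun i => Fin.ext (h i))
    · rfl

theorem gcLayer_eq_one {d Hin Hout R S o rin rout : ℕ}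
    (W : (Fin d → Fin R) → Matrix (Fin rout) (Fin rin) ℝ) (x : (Fin d → Fin Hin) → Fin rin → ℝ)
    (c : Fin rout) (h : ∀ w q, Matrix.mulVec (W w) (x q) c = 1) (p : Fin d → Fin Hout) :
    gcLayer Hin Hout R S o W x p c = 1 := by
  refine Finset.prod_eq_one fun w _ => ?_
  split_ifs
  · exact h _ _
  · rfl

/-- A convolution that reads the functional `v` at the anchor and `1` elsewhere outputs the values
of `v` on its input. -/
theorem prod_gcLayer_anchor {d Hin Hout R S o rin rout : ℕ} (hH : Hout = Hin) (hS : S = 1)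
    (ho : o < R) (W : (Fin d → Fin R) → Matrix (Fin rout) (Fin rin) ℝ)
    (x : (Fin d → Fin Hin) → Fin rin → ℝ) (c : Fin rout) (v : Fin rin → ℝ)
    (hW : ∀ w, (∀ i, (w i : ℕ) = o) → W w c = v)
    (hW' : ∀ w, (¬ ∀ i, (w i : ℕ) = o) → ∀ q, Matrix.mulVec (W w) (x q) c = 1) :
    ∏ p, gcLayer Hin Hout R S o W x p c = ∏ q, v ⬝ᵥ x q := by
  subst hH hS
  refine Finset.prod_congr rfl fun p _ => ?_
  rw [gcLayer, Finset.prod_eq_single fun _ => ⟨o, ho⟩]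
  · rw [dif_pos fun i => by simp]
    simp only [Matrix.mulVec, hW (fun _ => ⟨o, ho⟩) fun _ => rfl]
    congr 2
    funext i
    simp
  · intro w _ hw
    split_ifs with h
    · exact hW' w (fun hc => hw (funext fun i => Fin.ext (hc i))) _
    · rfl
  · simp

/-- Pooling with the functional `v` at every window location multiplies the values of `v` on the
blocks of the input grid. -/
theorem prod_gcLayer_pooling {d Hin Hout R S o rin rout : ℕ} (hH : Hin = Hout * 2) (hR : R = 2)
    (hS : S = 2) (ho : o = 0) (W : (Fin d → Fin R) → Matrix (Fin rout) (Fin rin) ℝ)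
    (x : (Fin d → Fin Hin) → Fin rin → ℝ) (c : Fin rout) (v : Fin rin → ℝ)
    (hW : ∀ w, W w c = v) :
    ∏ p, gcLayer Hin Hout R S o W x p c = ∏ q, v ⬝ᵥ x q := by
  subst hH hR hS ho
  simp only [gcLayer]
  rw [← Fintype.prod_prod_type']
  let φ : ((Fin d → Fin Hout) × (Fin d → Fin 2)) ≃ (Fin d → Fin (Hout * 2)) :=
    (Equiv.arrowProdEquivProdArrow _ _ _).symm.trans
      (Equiv.piCongrRight fun _ => finProdFinEquiv)
  refine Fintype.prod_equiv φ _ _ fun z => ?_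
  have hval : ∀ i, (φ z i : ℕ) = 2 * (z.1 i : ℕ) + (z.2 i : ℕ) - 0 := fun i => by
    simp [φ, Equiv.arrowProdEquivProdArrow, finProdFinEquiv, add_comm]
  rw [dif_pos fun i => ⟨Nat.zero_le _, (hval i) ▸ (φ z i).2⟩, Matrix.mulVec, hW]
  congr 2
  funext i
  exact Fin.ext (hval i).symm

theorem gcLayer_global {d Hin S rin rout : ℕ}
    (W : (Fin d → Fin Hin) → Matrix (Fin rout) (Fin rin) ℝ)
    (x : (Fin d → Fin Hin) → Fin rin → ℝ) (p : Fin d → Fin 1) (c : Fin rout) (v : Fin rin → ℝ)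
    (hW : ∀ w, W w c = v) :
    gcLayer Hin 1 Hin S 0 W x p c = ∏ q, v ⬝ᵥ x q := by
  refine Finset.prod_congr rfl fun w _ => ?_
  rw [dif_pos fun i => by simp, Matrix.mulVec, hW]
  congr 2
  funext i
  simp

/-- Coefficients of the linear functional that recovers the signs from the input of layer `l`.
After the first convolution channel `0` is constantly `1` and channel `1` is a product of two
parities `β β'`, whose sign is `1 - 2 β β'`; from then on channel `1` holds the signs. -/
def signRow (l c : ℕ) : ℝ :=
  if l = 1 then if c = 0 then 1 else if c = 1 then -2 else 0 else if c = 1 then 1 else 0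

/-- Weights that represent the graph state with edges between the sites at the window locations
`axisLoc o c₀` and `axisLoc o c₁`. Channel `0` of every layer is constantly `1`, channel `1`
carries the signs, and all other channels are ignored. -/
def graphParams (d n K M H : ℕ) (r : ℕ → ℕ) (o c₀ c₁ : ℕ) : Params d n K M H r where
  W l w c x :=
    if l = 0 then
      if (c : ℕ) = 1 ∧
        ((∀ i, (w i : ℕ) = axisLoc o c₀ i) ∨ (∀ i, (w i : ℕ) = axisLoc o c₁ i)) then parity x else 1
    else if (c : ℕ) = 1 ∧ (¬ Even l ∨ ∀ i, (w i : ℕ) = o) then signRow l x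
    else if (x : ℕ) = 0 then 1 else 0
  V _ _ x := signRow n x

theorem dotProduct_eq_zero_channel {N : ℕ} (hN : 2 ≤ N) (x : Fin N → ℝ) :
    (fun c : Fin N => if (c : ℕ) = 0 then (1 : ℝ) else 0) ⬝ᵥ x = x ⟨0, by omega⟩ := by
  rw [dotProduct, Finset.sum_eq_single ⟨0, by omega⟩]
  · simp
  · intro c _ hc
    rw [if_neg fun h => hc (Fin.ext h), zero_mul]
  · simp

theorem signRow_one_dotProduct {N : ℕ} (hN : 2 ≤ N) (x : Fin N → ℝ) :
    (fun c : Fin N => signRow 1 c) ⬝ᵥ x = x ⟨0, by omega⟩ - 2 * x ⟨1, by omega⟩ := by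
  rw [dotProduct, Fintype.sum_eq_add ⟨0, by omega⟩ ⟨1, by omega⟩ (Fin.ne_of_val_ne zero_ne_one)]
  · simp [signRow]
    ring
  · rintro c ⟨h0, h1⟩
    rw [signRow, if_pos rfl, if_neg fun h => h0 (Fin.ext h), if_neg fun h => h1 (Fin.ext h),
      zero_mul]

theorem signRow_dotProduct {N l : ℕ} (hN : 2 ≤ N) (hl : l ≠ 1) (x : Fin N → ℝ) :
    (fun c : Fin N => signRow l c) ⬝ᵥ x = x ⟨1, by omega⟩ := by
  rw [dotProduct, Fintype.sum_eq_single ⟨1, by omega⟩]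
  · simp [signRow, hl]
  · intro c h1
    rw [signRow, if_neg hl, if_neg fun h => h1 (Fin.ext h), zero_mul]

theorem extent_eq (H l : ℕ) : extent H l = H / 2 ^ (l / 2) := by
  induction l with
  | zero => simp [extent]
  | succ l ih =>
    rw [extent, ih, stride]
    split_ifs with h
    · rw [Nat.div_one, show (l + 1) / 2 = l / 2 by
        obtain ⟨m, rfl⟩ := h
        omega]
    · rw [Nat.div_div_eq_div_mul, ← pow_succ, show (l + 1) / 2 = l / 2 + 1 by
        obtain ⟨m, rfl⟩ := Nat.not_even_iff_odd.1 h
        omega]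

theorem extent_eq_mul_two {H n l : ℕ} (hH : 2 ^ (n / 2) ∣ H) (hl : l < n) (ho : ¬ Even l) :
    extent H l = extent H (l + 1) * 2 := by
  obtain ⟨m, rfl⟩ := Nat.not_even_iff_odd.1 ho
  have h1 : 2 ^ (m + 1) ∣ H := (pow_dvd_pow 2 (by omega)).trans hH
  obtain ⟨q, rfl⟩ := h1
  rw [extent_eq, extent_eq, show (2 * m + 1) / 2 = m by omega,
    show (2 * m + 1 + 1) / 2 = m + 1 by omega, Nat.mul_div_cancel_left _ (by positivity), pow_succ,
    mul_assoc, Nat.mul_div_cancel_left _ (by positivity), mul_comm]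

variable {d n K M H : ℕ} {r : ℕ → ℕ} {o c₀ c₁ : ℕ}

/-- Through all layers channel `0` stays constant and the product of the signs is preserved. -/
theorem activation_graphParams (hd : 0 < d) (hr : ∀ l < n, 2 ≤ channels M r (l + 1))
    (hH : 2 ^ (n / 2) ∣ H) (ho : o < K) (hc₀ : c₀ < K) (hc₁ : c₁ < K) (hne : c₀ ≠ c₁) (s : (Fin d → Fin H) → Fin M)
    (l : ℕ) (hl : l < n) :
    (∀ p, activation o (graphParams d n K M H r o c₀ c₁) s (l + 1) p
        ⟨0, Nat.lt_of_lt_of_le Nat.two_pos (hr l hl)⟩ = 1) ∧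
      ∏ p, (fun c : Fin (channels M r (l + 1)) => signRow (l + 1) c) ⬝ᵥ
        activation o (graphParams d n K M H r o c₀ c₁) s (l + 1) p =
        graphState (axisSite o c₀) (axisSite o c₁) s := by
  induction l with
  | zero =>
    have h0 : ∀ p, activation o (graphParams d n K M H r o c₀ c₁) s (0 + 1) p
        ⟨0, Nat.lt_of_lt_of_le Nat.two_pos (hr 0 hl)⟩ = 1 := by
      intro p
      refine gcLayer_eq_one _ _ _ (fun w q => ?_) p
      refine (mulVec_single_one_apply _ _ _).trans ?_
      simp [graphParams]
    refine ⟨h0, ?_⟩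
    have h1 := prod_gcLayer_parity (R := field K 0) (S := stride 0) (Hout := extent H 1)
      (o' := anchor o 0) (o := o) (c₀ := c₀) (c₁ := c₁) hd (by simp [extent, stride])
      (by simp [stride]) (by simp [anchor]) (by simpa [field]) (by simpa [field])
      (by simpa [field]) hne ((graphParams d n K M H r o c₀ c₁).W 0) ⟨1, hr 0 hl⟩
      (fun w x => by simp [graphParams]) s
    refine Eq.trans (Finset.prod_congr rfl fun p _ => ?_) h1
    refine (signRow_one_dotProduct (hr 0 hl) _).trans ?_
    rw [h0]
    rfl
  | succ l ih =>
    obtain ⟨h0, h1⟩ := ih (Nat.lt_of_succ_lt hl)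
    have hr' : 2 ≤ channels M r (l + 1) := hr l (Nat.lt_of_succ_lt hl)
    refine ⟨fun p => ?_, ?_⟩
    · refine gcLayer_eq_one _ _ _ (fun w q => ?_) p
      rw [← h0 q, ← dotProduct_eq_zero_channel hr' (activation _ _ _ _ _)]
      refine congrArg (· ⬝ᵥ _) (funext fun x => ?_)
      simp [graphParams]
    · rw [← h1]
      refine (Finset.prod_congr rfl fun p _ =>
        signRow_dotProduct (hr (l + 1) hl) (by omega) _).trans ?_
      by_cases he : Even (l + 1)
      · refine prod_gcLayer_anchor (Hout := extent H (l + 1 + 1)) (Hin := extent H (l + 1))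
          (by simp [extent, stride, he]) (by simp [stride, he]) (by simpa [anchor, field, he])
          _ _ _ _ (fun w hw => ?_) fun w hw q => ?_
        · funext x
          simp only [anchor, he, if_true] at hw
          simp [graphParams, hw]
        · simp only [anchor, he, if_true] at hw
          rw [← h0 q, ← dotProduct_eq_zero_channel hr' (activation _ _ _ _ _)]
          refine congrArg (· ⬝ᵥ _) (funext fun x => ?_)
          simp [graphParams, hw, he]
      · refine prod_gcLayer_pooling (Hout := extent H (l + 1 + 1)) (Hin := extent H (l + 1))
          (extent_eq_mul_two hH hl he) (by simp [field, he]) (by simp [stride, he])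
          (by simp [anchor, he]) _ _ _ _ fun w => ?_
        funext x
        simp [graphParams, he]

theorem state_graphParams (hd : 0 < d) (hn : 1 ≤ n) (hr : ∀ l < n, 2 ≤ r l)
    (hH : 2 ^ (n / 2) ∣ H) (ho : o < K) (hc₀ : c₀ < K) (hc₁ : c₁ < K) (hne : c₀ ≠ c₁) :
    state o (graphParams d n K M H r o c₀ c₁) =
      graphState (axisSite o c₀) (axisSite o c₁) := by
  funext s
  obtain ⟨l, rfl⟩ := Nat.exists_eq_add_of_le' hn
  rw [← (activation_graphParams hd (fun l hl => hr l hl) hH ho hc₀ hc₁ hne s l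
    (Nat.lt_succ_self l)).2]
  exact gcLayer_global _ _ _ _ _ fun w => rfl

end Network

/-! ### The cube and its shifted neighbours -/

section Geometry

variable {d H : ℕ}

/-- The site `b` is the translate of `a` by `k` along the first axis. -/
def IsShift (k : ℕ) (a b : Fin d → Fin H) : Prop :=
  ∀ x, (b x : ℕ) = a x + if (x : ℕ) = 0 then k else 0

theorem axisSite_eq_some {o c : ℕ} {p q : Fin d → Fin H} :
    axisSite o c p = some q ↔ ∀ x, (q x : ℕ) + o = p x + axisLoc o c x := by
  unfold axisSite
  split_ifs with h
  · rw [Option.some_inj, funext_iff]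
    refine forall_congr' fun x => ?_
    rw [Fin.ext_iff]
    have := (h x).1
    simp only
    omega
  · simp only [false_iff]
    refine fun hq => h fun x => ?_
    have := hq x
    have := (q x).2
    omega

theorem axisSite_injective {o c : ℕ} {p p' q : Fin d → Fin H} (h : axisSite o c p = some q)
    (h' : axisSite o c p' = some q) : p = p' := by
  rw [axisSite_eq_some] at h h'
  funext x
  have := h x
  have := h' x
  exact Fin.ext (by omega)

theorem isShift_of_axisSite {o c k : ℕ} {p a b : Fin d → Fin H} (ha : axisSite o c p = some a)
    (hb : axisSite o (c + k) p = some b) : IsShift k a b := by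
  rw [axisSite_eq_some] at ha hb
  intro x
  have h1 := ha x
  have h2 := hb x
  unfold axisLoc at h1 h2
  split_ifs at * <;> omega

/-- If the anchor lies between the two window locations then the output position that sees both
ends of an edge lies between them, hence inside the grid. -/
theorem exists_axisSite {o c k : ℕ} (hc : c ≤ o) (ho : o ≤ c + k) {a b : Fin d → Fin H}
    (h : IsShift k a b) : ∃ p, axisSite o c p = some a ∧ axisSite o (c + k) p = some b := by
  refine ⟨fun x => ⟨a x + o - axisLoc o c x, ?_⟩, ?_⟩
  · have h1 := h x
    have h2 := (b x).2
    unfold axisLoc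
    split_ifs at * <;> omega
  · simp only [axisSite_eq_some]
    constructor <;> intro x <;> have h1 := h x <;> unfold axisLoc <;> split_ifs at * <;> omega

/-- A set `I` of sites of `A`, each joined by a shift in a common direction to a site outside `A`
whose shift in that direction also lies outside `A`, yields entanglement proportional to its
size. -/
theorem card_mul_le_maxEE_of_isShift {n K o M k : ℕ} {r : ℕ → ℕ} (hd : 0 < d) (hn : 1 ≤ n)
    (hr : ∀ l < n, 2 ≤ r l) (hH : 2 ^ (n / 2) ∣ H) (ho : o < K) (hM : 2 ≤ M) (hk : 1 ≤ k)
    (hkK : k < K) (A : Finset (Fin d → Fin H)) (hA : Nonempty {j // j ∉ A})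
    (I : Finset {j // j ∈ A})
    (hI : (∀ i ∈ I, ∃ j : {j // j ∉ A}, IsShift k i.1 j.1 ∧ ∀ i' ∈ A, ¬ IsShift k j.1 i') ∨
      ∀ i ∈ I, ∃ j : {j // j ∉ A}, IsShift k j.1 i.1 ∧ ∀ i' ∈ A, ¬ IsShift k i' j.1) :
    I.card * Real.log (81 / 49) ≤ maxEE d n K o M H r A := by
  have hc : o - k ≤ o := Nat.sub_le _ _
  have hc' : o ≤ o - k + k := by omega
  have hstate := state_graphParams (M := M) hd hn hr hH ho (show o - k < K by omega)
    (show o - k + k < K by omega) (by omega)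
  have hne : state o (graphParams d n K M H r o (o - k) (o - k + k)) ≠ 0 := by
    rw [hstate]
    intro h
    have := graphState_mul_self (axisSite o (o - k)) (axisSite o (o - k + k))
      (fun _ : Fin d → Fin H => (⟨0, by omega⟩ : Fin M))
    rw [h] at this
    simp at this
  refine le_trans ?_ (entanglementEntropy_le_maxEE A _ hne)
  rw [hstate]
  rcases hI with hI | hI
  · have h1 : ∀ i : {j // j ∈ A}, ∃ j : {j // j ∉ A}, i ∈ I →
        IsShift k i.1 j.1 ∧ ∀ i' ∈ A, ¬ IsShift k j.1 i' := fun i => by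
      by_cases hi : i ∈ I
      · exact (hI i hi).imp fun _ h _ => h
      · exact ⟨hA.some, fun h => absurd h hi⟩
    choose ν hν using h1
    have h2 : ∀ i : {j // j ∈ A}, ∃ p, i ∈ I →
        axisSite o (o - k) p = some i.1 ∧ axisSite o (o - k + k) p = some (ν i).1 := fun i => by
      by_cases hi : i ∈ I
      · exact (exists_axisSite hc hc' (hν i hi).1).imp fun _ h _ => h
      · exact ⟨i.1, fun h => absurd h hi⟩
    choose e he using h2
    refine card_mul_le_entanglementEntropy_graphState hM I ν e (fun i hi => Or.inr (he i hi)) ?_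
    rintro i hi p i' hi' (⟨h3, h4⟩ | ⟨h3, h4⟩)
    · exact absurd (isShift_of_axisSite h3 h4) ((hν i hi).2 i' hi')
    · exact axisSite_injective h4 (he i hi).2
  · have h1 : ∀ i : {j // j ∈ A}, ∃ j : {j // j ∉ A}, i ∈ I →
        IsShift k j.1 i.1 ∧ ∀ i' ∈ A, ¬ IsShift k i' j.1 := fun i => by
      by_cases hi : i ∈ I
      · exact (hI i hi).imp fun _ h _ => h
      · exact ⟨hA.some, fun h => absurd h hi⟩
    choose ν hν using h1
    have h2 : ∀ i : {j // j ∈ A}, ∃ p, i ∈ I →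
        axisSite o (o - k) p = some (ν i).1 ∧ axisSite o (o - k + k) p = some i.1 := fun i => by
      by_cases hi : i ∈ I
      · exact (exists_axisSite hc hc' (hν i hi).1).imp fun _ h _ => h
      · exact ⟨i.1, fun h => absurd h hi⟩
    choose e he using h2
    refine card_mul_le_entanglementEntropy_graphState hM I ν e (fun i hi => Or.inl (he i hi)) ?_
    rintro i hi p i' hi' (⟨h3, h4⟩ | ⟨h3, h4⟩)
    · exact axisSite_injective h3 (he i hi).1
    · exact absurd (isShift_of_axisSite h3 h4) ((hν i hi).2 i' hi')

theorem card_filter_cuboid (lo len : Fin d → ℕ) (h : ∀ x, lo x + len x ≤ H) :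
    (Finset.univ.filter fun j : Fin d → Fin H =>
      ∀ x, lo x ≤ (j x : ℕ) ∧ (j x : ℕ) < lo x + len x).card = ∏ x, len x := by
  have h1 : (Finset.univ.filter fun j : Fin d → Fin H =>
      ∀ x, lo x ≤ (j x : ℕ) ∧ (j x : ℕ) < lo x + len x) =
      Fintype.piFinset fun x => Finset.univ.filter fun y : Fin H =>
        lo x ≤ (y : ℕ) ∧ (y : ℕ) < lo x + len x := by
    ext j
    simp
  rw [h1, Fintype.card_piFinset]
  refine Finset.prod_congr rfl fun x _ => ?_
  have h2 : (Finset.univ.filter fun y : Fin H => lo x ≤ (y : ℕ) ∧ (y : ℕ) < lo x + len x).map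
      Fin.valEmbedding = Finset.Ico (lo x) (lo x + len x) := by
    ext y
    simp only [Finset.mem_map, Finset.mem_filter, Finset.mem_univ, true_and, Finset.mem_Ico,
      Fin.valEmbedding_apply]
    constructor
    · rintro ⟨y, hy, rfl⟩
      exact hy
    · intro hy
      exact ⟨⟨y, by have := h x; omega⟩, hy, rfl⟩
  rw [← Finset.card_map Fin.valEmbedding, h2, Nat.card_Ico, Nat.add_sub_cancel_left]

theorem card_box {α : ℕ} {t : Fin d → ℕ} (ht : ∀ i, t i + α ≤ H) :
    (box H α t).card = α ^ d := by
  rw [box, card_filter_cuboid t (fun _ => α) ht]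
  simp

/-- The slab of thickness `m` of the cube `box H α t` that starts at the coordinate `a` of the
first axis. -/
def slab (H α : ℕ) (t : Fin d → ℕ) (a m : ℕ) : Finset (Fin d → Fin H) :=
  Finset.univ.filter fun j => ∀ x : Fin d, (if (x : ℕ) = 0 then a else t x) ≤ (j x : ℕ) ∧
    (j x : ℕ) < (if (x : ℕ) = 0 then a else t x) + if (x : ℕ) = 0 then m else α

theorem card_slab {α a m : ℕ} {t : Fin d → ℕ} (hd : 0 < d) (ht : ∀ i, t i + α ≤ H)
    (ham : a + m ≤ H) : (slab H α t a m).card = m * α ^ (d - 1) := by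
  rw [slab, card_filter_cuboid _ _ fun x => by split_ifs <;> simp [ham, ht]]
  obtain ⟨d, rfl⟩ := Nat.exists_eq_add_of_le' hd
  rw [Fin.prod_univ_succ]
  simp

theorem slab_subset_box {α a m : ℕ} {t : Fin d → ℕ} (h : ∀ x : Fin d, (x : ℕ) = 0 → t x ≤ a)
    (h' : ∀ x : Fin d, (x : ℕ) = 0 → a + m ≤ t x + α) : slab H α t a m ⊆ box H α t := by
  intro j hj
  simp only [slab, box, Finset.mem_filter, Finset.mem_univ, true_and] at hj ⊢
  intro x
  have h1 := hj x
  have h2 := h x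
  have h3 := h' x
  split_ifs at h1 <;> omega

/-- The entanglement across the face of a cube with room for `m` sites next to it, when sites at
distance `k` along the first axis are joined. -/
theorem mul_log_le_maxEE_box {n K o M k α m : ℕ} {r : ℕ → ℕ} {t : Fin d → ℕ} (hd : 0 < d)
    (hn : 1 ≤ n) (hr : ∀ l < n, 2 ≤ r l) (hH : 2 ^ (n / 2) ∣ H) (ho : o < K) (hM : 2 ≤ M)
    (hk : 1 ≤ k) (hkK : k < K) (ht : ∀ i, t i + α ≤ H) (hA : Nonempty {j // j ∉ box H α t})
    (hmk : m ≤ k) (hkα : k ≤ α) (hm : t ⟨0, hd⟩ + α + m ≤ H ∨ m ≤ t ⟨0, hd⟩) :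
    ((m * α ^ (d - 1) : ℕ) : ℝ) * Real.log (81 / 49) ≤ maxEE d n K o M H r (box H α t) := by
  have hz : ∀ x : Fin d, (x : ℕ) = 0 → t x = t ⟨0, hd⟩ := fun x hx =>
    congrArg t (Fin.ext hx)
  have ht0 := ht ⟨0, hd⟩
  have key : ∀ a, t ⟨0, hd⟩ ≤ a → a + m ≤ t ⟨0, hd⟩ + α →
      ((∀ i ∈ slab H α t a m, ∃ j : {j // j ∉ box H α t}, IsShift k i j.1 ∧
          ∀ i' ∈ box H α t, ¬ IsShift k j.1 i') ∨
        ∀ i ∈ slab H α t a m, ∃ j : {j // j ∉ box H α t}, IsShift k j.1 i ∧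
          ∀ i' ∈ box H α t, ¬ IsShift k i' j.1) →
      ((m * α ^ (d - 1) : ℕ) : ℝ) * Real.log (81 / 49) ≤
        maxEE d n K o M H r (box H α t) := by
    intro a ha ham h
    have hsub : slab H α t a m ⊆ box H α t :=
      slab_subset_box (fun x hx => (hz x hx).trans_le ha) fun x hx => by rwa [hz x hx]
    have hcard : ((slab H α t a m).subtype (· ∈ box H α t)).card = m * α ^ (d - 1) := by
      rw [Finset.card_subtype, Finset.filter_true_of_mem fun j hj => hsub hj,
        card_slab hd ht (ham.trans ht0)]
    rw [← hcard]
    refine card_mul_le_maxEE_of_isShift hd hn hr hH ho hM hk hkK _ hA _ (h.imp ?_ ?_) <;>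
    · intro h i hi
      exact h i.1 (Finset.mem_subtype.1 hi)
  have hmem : ∀ i ∈ box H α t, t ⟨0, hd⟩ ≤ i ⟨0, hd⟩ ∧ i ⟨0, hd⟩ < t ⟨0, hd⟩ + α := fun i hi =>
    (Finset.mem_filter.1 hi).2 _
  rcases hm with hm | hm
  · refine key (t ⟨0, hd⟩ + α - k) (by omega) (by omega) (Or.inl fun i hi => ?_)
    have hi := (Finset.mem_filter.1 hi).2
    have hi0 := hi ⟨0, hd⟩
    simp only [if_true] at hi0
    let j : Fin d → Fin H := fun x => ⟨i x + if (x : ℕ) = 0 then k else 0, by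
      have h1 := hi x
      have h2 := hz x
      have h3 := ht x
      split_ifs at * with h <;> omega⟩
    have hj0 : (j ⟨0, hd⟩ : ℕ) = i ⟨0, hd⟩ + k := by simp [j]
    refine ⟨⟨j, fun hj => ?_⟩, fun x => rfl, fun i' hi' h => ?_⟩
    · have := hmem j hj
      omega
    · have h1 := h ⟨0, hd⟩
      have h2 := hmem i' hi'
      simp only [if_true] at h1
      omega
  · refine key (t ⟨0, hd⟩ + k - m) (by omega) (by omega) (Or.inr fun i hi => ?_)
    have hi := (Finset.mem_filter.1 hi).2
    have hi0 := hi ⟨0, hd⟩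
    simp only [if_true] at hi0
    let j : Fin d → Fin H := fun x => ⟨i x - if (x : ℕ) = 0 then k else 0,
      (Nat.sub_le _ _).trans_lt (i x).2⟩
    have hj0 : (j ⟨0, hd⟩ : ℕ) = i ⟨0, hd⟩ - k := by simp [j]
    refine ⟨⟨j, fun hj => ?_⟩, fun x => ?_, fun i' hi' h => ?_⟩
    · have := hmem j hj
      omega
    · have h1 := hi x
      have h2 := hz x
      simp only [j]
      split_ifs at * with h <;> omega
    · have h1 := h ⟨0, hd⟩
      have h2 := hmem i' hi'
      simp only [if_true] at h1
      omega

end Geometry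

end ConvAC

theorem theorem3 :
    ∃ c : ℝ, 0 < c ∧
      ∀ (d n K o M H α : ℕ) (r : ℕ → ℕ) (t : Fin d → ℕ),
        (d = 1 ∨ d = 2) → 1 ≤ n → 2 ≤ K → o < K → 2 ≤ M → (∀ l < n, 2 ≤ r l) →
        2 ^ (n / 2) ∣ H → 1 ≤ α → (∀ i, t i + α ≤ H) →
        (ConvAC.box H α t).card ≤ (ConvAC.box H α t)ᶜ.card →
        c * min ((α : ℝ) ^ d) ((K : ℝ) * (α : ℝ) ^ (d - 1))
          ≤ ConvAC.maxEE d n K o M H r (ConvAC.box H α t) := by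
  have hlog : 0 < Real.log (81 / 49) := Real.log_pos (by norm_num)
  refine ⟨Real.log (81 / 49) / 5, by positivity, ?_⟩
  intro d n K o M H α r t hd hn hK ho hM hr hH hα ht hcard
  have hd0 : 0 < d := by omega
  have ht0 := ht ⟨0, hd0⟩
  have hA : Nonempty {j // j ∉ ConvAC.box H α t} := by
    have h1 : 0 < (ConvAC.box H α t)ᶜ.card := by
      refine lt_of_lt_of_le ?_ hcard
      rw [ConvAC.card_box ht]
      positivity
    obtain ⟨j, hj⟩ := Finset.card_pos.1 h1
    exact ⟨⟨j, Finset.mem_compl.1 hj⟩⟩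
  -- `5 / 7` is a rational upper bound of `1 / √2`, so that some side of the cube has room for
  -- at least `α / 5` sites
  have hroom : 7 * α ≤ 5 * H := by
    rw [Finset.card_compl, ConvAC.card_box ht] at hcard
    simp only [Fintype.card_fun, Fintype.card_fin] at hcard
    rcases hd with rfl | rfl
    · rw [pow_one, pow_one] at hcard
      omega
    · have h1 : 2 * α ^ 2 ≤ H ^ 2 := by
        have : 0 < α ^ 2 := by positivity
        omega
      by_contra h2
      push Not at h2
      nlinarith
  obtain ⟨side, hside, hα5⟩ : ∃ side, (t ⟨0, hd0⟩ + α + side ≤ H ∨ side ≤ t ⟨0, hd0⟩) ∧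
      α ≤ 5 * side := by
    rcases Nat.lt_or_ge (5 * t ⟨0, hd0⟩) α with h | h
    · exact ⟨H - α - t ⟨0, hd0⟩, Or.inl (by omega), by omega⟩
    · exact ⟨t ⟨0, hd0⟩, Or.inr le_rfl, h⟩
  -- `k < K` is the largest distance that a window allows, and `k ≤ α` keeps the partner of a site
  -- beyond the face inside the cube
  have hmain := ConvAC.mul_log_le_maxEE_box (k := min α (K - 1))
    (m := min (min α (K - 1)) side) hd0 hn hr hH ho hM (by omega) (by omega) ht hA (by omega)
    (by omega) (hside.imp (fun h => by omega) fun h => by omega)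
  refine le_trans ?_ hmain
  have hmin : min α K ≤ 5 * min (min α (K - 1)) side := by omega
  have hminR : min (α : ℝ) K ≤ 5 * (min (min α (K - 1)) side : ℕ) := by exact_mod_cast hmin
  have hpow : min ((α : ℝ) ^ d) ((K : ℝ) * (α : ℝ) ^ (d - 1)) =
      min (α : ℝ) K * (α : ℝ) ^ (d - 1) := by
    rw [min_mul_of_nonneg _ _ (by positivity), ← pow_succ', Nat.sub_add_cancel hd0]
  rw [hpow, Nat.cast_mul, Nat.cast_pow]
  have h1 : (0 : ℝ) ≤ (α : ℝ) ^ (d - 1) * Real.log (81 / 49) := by positivity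
  nlinarith [mul_le_mul_of_nonneg_right hminR h1]
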